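/- Let $G=(V,E)$ be a finite directed acyclic multigraph with a source node $s$ and a set $T$ of $l$ sink nodes, let $\mathcal F$ be a finite field, and let $w$ be the information rate. Random linear network coding on $G$ works as follows. For every pair of channels $(d,e)$ such that $d$ enters the tail of $e$, a local coefficient $k_{d,e}\in\mathcal F$ is chosen, independently and uniformly; here $w$ imaginary channels $d_1,\dots,d_w$ entering $s$ carry the source symbols. The global encoding kernels are the column vectors $f_e\in\mathcal F^w$ given by $f_e=\sum_d k_{d,e}f_d$ (sum over the channels $d$ entering the tail of $e$), with $f_{d_1},\dots,f_{d_w}$ the standard basis. For $t\in T$ let $F_t$ be the matrix whose columns are the $f_e$ for the channels $e$ entering $t$. The failure probability of the network is $P_e=\Pr(\exists\, t\in T:\ \operatorname{rank}F_t<w)$. Fix, for each sink $t\in T$, $w$ pairwise channel-disjoint directed paths from $s$ to $t$ such that no sink is an intermediate node of a chosen path. Let $R$ be the number of internal nodes (nodes other than $s$ and the sinks) on the union of all chosen paths, and let $s=i_0\prec i_1\prec\dots\prec i_R$ be an enumeration of $s$ and these internal nodes in topological order of $G$ (if there is a directed path in $G$ from $i_j$ to $i_k$, then $j<k$). For $0\le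 k\le R$ let $m_k$ be the number of sinks at least one of whose $w$ paths passes through $i_k$, and let $n_k$ be the number of those among them for which $i_k$ is the last of the nodes $i_0,\dots,i_R$ lying on their $w$ paths. Put $a=1-\prod_{h=1}^w\left(1-|\mathcal F|^{-h}\right)$. (1) If $(m_k-n_k)\,a\le 1$ for all $0\le k\le R-1$, i.e. if no factor of the product below is negative, then $$P_e\le 1-(1-a)^l\prod_{k=0}^{R-1}\bigl[1-(m_k-n_k)a\bigr].$$ (2) The bound is attained: for all $w\ge1$, $l\ge1$, $R\ge0$ let $G_2$ be the network with source $s=i_0$, internal nodes $i_1,\dots,i_R$, sinks $t_1,\dots,t_l$, and exactly the following channels: $w$ parallel channels from $i_{k}$ to $i_{k+1}$ for $0\le k<R$, $w$ parallel channels from $i_R$ to $t_1$, and $w$ parallel channels from $s$ to $t_j$ for $2\le j\le l$ (a union of $l$ plait networks with common source). Then paths and an ordering as above with $R$ internal nodes exist for $G_2$, and for every such choice the hypothesis of (1) holds and (1) is an equality; moreover $P_e(G_2)=1-(1-a)^{R+l}$. -/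

import Mathlib

/-- A single-source multicast network: a directed multigraph without directed cycles, with nodes `V`
and channels `E` (parallel channels are allowed), a source node and a set of sink nodes. -/
structure Network (V E : Type*) where
  tail : E → V
  head : E → V
  source : V
  sinks : Finset V
  acyclic : ∀ v, ¬ Relation.TransGen (fun x y => ∃ e, tail e = x ∧ head e = y) v v

namespace Network

section Basic

variable {V E : Type*} (N : Network V E)

/-- There is a channel leading from `x` to `y`. -/
def Adj (x y : V) : Prop := ∃ e, N.tail e = x ∧ N.head e = y

/-- The head of a channel, where the channels are the real ones (`Sum.inr e`) together with `w`
imaginary channels (`Sum.inl i`), which carry the `w` source symbols into the source node. -/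
def headExt {w : ℕ} : Fin w ⊕ E → V := Sum.elim (fun _ => N.source) N.head

/-- A choice of all local encoding coefficients `k d e`, one for each adjacent pair of
channels `(d, e)`, i.e. `e` is a real channel and `d` an incoming channel of the tail of `e`. -/
abbrev Coeff (F : Type*) (w : ℕ) : Type _ :=
  (e : E) → {d : Fin w ⊕ E // N.headExt d = N.tail e} → F

theorem wellFounded_channels [Finite E] : WellFounded fun d e : E => N.head d = N.tail e := by
  have key : ∀ d e : E, Relation.TransGen (fun d e : E => N.head d = N.tail e) d e →
      Relation.TransGen N.Adj (N.tail d) (N.tail e) := by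
    intro d e h
    induction h with
    | single h => exact .single ⟨d, rfl, h⟩
    | tail _ h ih => exact ih.tail ⟨_, rfl, h⟩
  have : Std.Irrefl (Relation.TransGen fun d e : E => N.head d = N.tail e) :=
    ⟨fun e h => N.acyclic _ (key e e h)⟩
  have wf := Finite.wellFounded_of_trans_of_irrefl
    (Relation.TransGen fun d e : E => N.head d = N.tail e)
  exact Subrelation.wf (r := Relation.TransGen fun d e : E => N.head d = N.tail e)
    (fun {_ _} h => Relation.TransGen.single h) wf

open Classical in
/-- The global encoding kernel `f_e` determined by the local encoding coefficients:
`f_e = ∑ d, k d e • f_d`, the sum running over the incoming channels `d` of the tail of `e`; the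
kernels of the `w` imaginary channels are the standard basis vectors. -/
noncomputable def kernel [Fintype E] {F : Type*} [Field F] {w : ℕ} (K : N.Coeff F w) :
    E → Fin w → F :=
  N.wellFounded_channels.fix fun e f =>
    ∑ d : {d : Fin w ⊕ E // N.headExt d = N.tail e},
      K e d • (match d with
        | ⟨Sum.inl i, _⟩ => Pi.single i 1
        | ⟨Sum.inr d', h⟩ => f d' h)

open Classical in
theorem kernel_eq [Fintype E] {F : Type*} [Field F] {w : ℕ} (K : N.Coeff F w) (e : E) :
    N.kernel K e = ∑ d : {d : Fin w ⊕ E // N.headExt d = N.tail e},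
      K e d • (Sum.elim (fun i => Pi.single i 1) (N.kernel K) d.1 : Fin w → F) := by
  rw [kernel, WellFounded.fix_eq]
  refine Finset.sum_congr rfl fun d _ => ?_
  rcases d with ⟨i | d', h⟩ <;> rfl

/-- The decoding matrix `F_t`, whose columns are the global encoding kernels of the incoming
channels of `t`. -/
noncomputable def decodingMatrix [Fintype E] {F : Type*} [Field F] {w : ℕ} (K : N.Coeff F w)
    (t : V) : Matrix (Fin w) {e : E // N.head e = t} F :=
  Matrix.of fun i e => N.kernel K e.1 i

open Classical in
/-- The failure probability `P_e` of random linear network coding over `F` at information rate `w`: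
the probability that `F_t` has rank less than `w` for at least one sink `t`. The local encoding
coefficients are independent and uniform on `F`, i.e. their joint law is the uniform
distribution on all choices of the coefficients. -/
noncomputable def failureProb [Fintype E] (F : Type*) [Field F] [Fintype F] (w : ℕ) : ℝ :=
  ((PMF.uniformOfFintype (N.Coeff F w)).toOuterMeasure
    {K | ∃ t ∈ N.sinks, (N.decodingMatrix K t).rank < w}).toReal

/-- `p` is the list of channels of a directed path (with at least one channel) from `x` to `y`. -/
def IsPath (x y : V) (p : List E) : Prop :=
  p.IsChain (fun d e => N.head d = N.tail e) ∧
    p.head?.map N.tail = some x ∧ p.getLast?.map N.head = some y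

/-- A choice, for every sink `t`, of `w` channel-disjoint paths from the source to `t`, such that
the union of all these paths has exactly `R` internal nodes, together with an enumeration
`s = i_0, i_1, …, i_R` of the source and these internal nodes in topological order. Internal nodes
of the paths are not sinks. -/
structure ChosenPaths (w R : ℕ) where
  path : V → Fin w → List E
  isPath : ∀ t ∈ N.sinks, ∀ j, N.IsPath N.source t (path t j)
  disjoint : ∀ t ∈ N.sinks, ∀ j j', j ≠ j' → (path t j).Disjoint (path t j')
  tail_notMem_sinks : ∀ t ∈ N.sinks, ∀ j, ∀ e ∈ path t j, N.tail e ∉ N.sinks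
  node : Fin (R + 1) → V
  node_injective : Function.Injective node
  node_zero : node 0 = N.source
  range_node : Set.range (fun k : Fin R => node k.succ) =
    {v | v ≠ N.source ∧ ∃ t ∈ N.sinks, ∃ j, ∃ e ∈ path t j, N.tail e = v}
  topological : ∀ k k', Relation.TransGen N.Adj (node k) (node k') → k < k'

end Basic

namespace ChosenPaths

variable {V E : Type*} {N : Network V E} {w R : ℕ} (P : N.ChosenPaths w R)

open Classical in
/-- `M_k`: the sinks at least one of whose `w` chosen paths passes through the node `i_k`. -/
noncomputable def M (k : Fin (R + 1)) : Finset V :=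
  N.sinks.filter fun t => ∃ j, ∃ e ∈ P.path t j, N.tail e = P.node k

open Classical in
/-- `N_k`: the sinks in `M_k` for which `i_k` is the last one of `i_0, …, i_R` on the `w`
chosen paths. -/
noncomputable def lastM (k : Fin (R + 1)) : Finset V :=
  (P.M k).filter fun t => ∀ k', k < k' → t ∉ P.M k'

/-- `m_k - n_k`, as a real number. -/
noncomputable def excess (k : Fin (R + 1)) : ℝ := ((P.M k).card : ℝ) - ((P.lastM k).card : ℝ)

end ChosenPaths

/-- The union, at a common source, of `l` plait networks of rate `w`: the one for the sink `inr 0`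
has the `R` internal nodes `inl 1, …, inl R`, those for the other sinks have none. The source is
`inl 0`. The channels are: for each `k < R`, `w` channels from `inl k` to `inl (k + 1)`; `w` channels
from `inl R` to the sink `inr 0`; and `w` channels from the source to each other sink. -/
def plaitUnion (w l R : ℕ) [NeZero l] :
    Network (Fin (R + 1) ⊕ Fin l) ((Fin R ⊕ Fin l) × Fin w) where
  tail e := Sum.elim (fun k => Sum.inl k.castSucc)
    (fun j => Sum.inl (if j = 0 then Fin.last R else 0)) e.1
  head e := Sum.elim (fun k => Sum.inl k.succ) (fun j => Sum.inr j) e.1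
  source := Sum.inl 0
  sinks := Finset.univ.map Function.Embedding.inr
  acyclic := by
    let ρ : Fin (R + 1) ⊕ Fin l → ℕ := Sum.elim (fun k => k.val) (fun _ => R + 1)
    intro v hv
    have key : ∀ x y, Relation.TransGen (fun x y => ∃ e : (Fin R ⊕ Fin l) × Fin w,
        Sum.elim (fun k => Sum.inl k.castSucc)
          (fun j => Sum.inl (if j = 0 then Fin.last R else 0)) e.1 = x ∧
        Sum.elim (fun k => Sum.inl k.succ) (fun j => Sum.inr j) e.1 = y) x y → ρ x < ρ y := by
      have step : ∀ e : (Fin R ⊕ Fin l) × Fin w,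
          ρ (Sum.elim (fun k => Sum.inl k.castSucc)
            (fun j => Sum.inl (if j = 0 then Fin.last R else 0)) e.1) <
          ρ (Sum.elim (fun k => Sum.inl k.succ) (fun j => Sum.inr j) e.1) := by
        rintro ⟨k | j, i⟩
        · simp [ρ]
        · simp only [ρ, Sum.elim_inr, Sum.elim_inl]
          exact (if j = 0 then Fin.last R else 0).isLt
      intro x y h
      induction h with
      | single h => obtain ⟨e, rfl, rfl⟩ := h; exact step e
      | tail _ h ih => obtain ⟨e, rfl, rfl⟩ := h; exact ih.trans (step e)
    exact lt_irrefl _ (key v v hv)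

end Network

/-- `a = 1 - ∏_{h=1}^w (1 - |F|^{-h})`. -/
noncomputable def stepFailure (F : Type*) [Fintype F] (w : ℕ) : ℝ :=
  1 - ∏ h ∈ Finset.Icc 1 w, (1 - 1 / (Fintype.card F : ℝ) ^ h)

/-- `1 - (1 - a)^l ∏_{k=0}^{R-1} (1 - (m_k - n_k) a)`, where `l` is the number of sinks. -/
noncomputable def Network.ChosenPaths.bound {V E : Type*} {N : Network V E} {w R : ℕ}
    (P : N.ChosenPaths w R) (F : Type*) [Fintype F] : ℝ :=
  1 - (1 - stepFailure F w) ^ N.sinks.card *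
    ∏ k : Fin R, (1 - P.excess k.castSucc * stepFailure F w)

/-! The nodes $i_0,\dots,i_R$ are processed in topological order. For each sink $t$, a cut of $w$
channels, one on each of its chosen paths, is maintained: it starts with the imaginary channels,
whose kernels are the standard basis, and after $i_R$ it consists of channels entering $t$. If the
kernels on the final cut are independent, $F_t$ has rank $w$. It therefore suffices to bound from
below the probability that the cuts of all sinks stay independent throughout.

Processing $i_k$ means resampling the coefficients of the channels leaving it. On each path through
$i_k$ a cut channel entering $i_k$ is replaced by one leaving it, whose kernel is a uniform
combination of all kernels entering $i_k$. Modulo the span of the unchanged cut vectors, the $r\le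
w$ new vectors are uniform and independent in a space of dimension $r$, so independence survives
with probability at least $1-a$ (`one_sub_stepFailure_le_uniformProb_replace`). Cuts of sinks
outside $M_k$ do not change.

For a sink whose last node is $i_k$, the new channels enter that sink directly. Such sinks thus use
pairwise disjoint sets of channels, also disjoint from those used by the other sinks; independence
gives the factor $(1-a)^{n_k}$. The remaining $m_k-n_k$ sinks are treated by the union bound, giving
$1-(m_k-n_k)a$ (`le_uniformProb_forall_cutIndep`). Multiplying over $k$ proves (1), since $\sum_k
n_k\le l$ and $m_R=n_R$.

In a union of plait networks each block of $w$ parallel channels acts by a $w\times w$ matrix of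
local coefficients. Success means that all $R+l$ of these independent uniform matrices are
invertible, which has probability $(1-a)^{R+l}$. For every admissible choice of paths $m_k-n_k=1$
for $k<R$, so the bound has the same value. -/

/-- The probability of the event `p` under the uniform distribution on a finite type. -/
noncomputable def uniformProb {Ω : Type*} (p : Ω → Prop) : ℝ :=
  (Nat.card {x // p x} : ℝ) / Nat.card Ω

/-! ### Uniform probability on finite types -/

section UniformProb

variable {Ω Ω' : Type*}

theorem uniformProb_nonneg (p : Ω → Prop) : 0 ≤ uniformProb p := by
  unfold uniformProb; positivity

theorem uniformProb_congr {p q : Ω → Prop} (h : ∀ x, p x ↔ q x) :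
    uniformProb p = uniformProb q := by
  rw [show p = q from funext fun x => propext (h x)]

theorem uniformProb_mono [Finite Ω] {p q : Ω → Prop} (h : ∀ x, p x → q x) :
    uniformProb p ≤ uniformProb q := by
  unfold uniformProb
  gcongr
  exact Nat.card_le_card_of_injective (Subtype.map id h)
    (Subtype.map_injective h Function.injective_id)

theorem uniformProb_of_forall [Finite Ω] [Nonempty Ω] {p : Ω → Prop} (h : ∀ x, p x) :
    uniformProb p = 1 := by
  unfold uniformProb
  rw [Nat.card_congr (Equiv.subtypeUnivEquiv h), div_self]
  exact_mod_cast Nat.card_pos.ne'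

theorem uniformProb_not [Finite Ω] [Nonempty Ω] (p : Ω → Prop) :
    uniformProb (fun x => ¬ p x) = 1 - uniformProb p := by
  classical
  have h : (Nat.card Ω : ℝ) ≠ 0 := by exact_mod_cast Nat.card_pos.ne'
  have := Nat.card_congr (Equiv.sumCompl p)
  rw [Nat.card_sum] at this
  unfold uniformProb
  rw [eq_sub_iff_add_eq, ← add_div, div_eq_one_iff_eq h, ← this]
  push_cast
  ring

theorem uniformProb_or_le [Finite Ω] (p q : Ω → Prop) :
    uniformProb (fun x => p x ∨ q x) ≤ uniformProb p + uniformProb q := by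
  classical
  have : Nat.card {x // p x ∨ q x} ≤ Nat.card {x // p x} + Nat.card {x // q x} := by
    rw [← Nat.card_sum]
    exact Nat.card_le_card_of_injective _ (subtypeOrLeftEmbedding p q).injective
  unfold uniformProb
  rw [← add_div]
  gcongr
  exact_mod_cast this

/-- The union bound. -/
theorem one_sub_sum_le_uniformProb [Finite Ω] [Nonempty Ω] {ι : Type*} (s : Finset ι)
    (p : ι → Ω → Prop) :
    1 - ∑ i ∈ s, (1 - uniformProb (p i)) ≤ uniformProb fun x => ∀ i ∈ s, p i x := by
  classical
  induction s using Finset.induction_on with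
  | empty => simp [uniformProb_of_forall (Ω := Ω) (p := fun _ => True) fun _ => trivial]
  | insert i s hi ih =>
    have h := uniformProb_or_le (fun x => ¬ p i x) (fun x => ¬ ∀ j ∈ s, p j x)
    rw [uniformProb_not, uniformProb_not,
      uniformProb_congr (q := fun x => ¬ ∀ j ∈ insert i s, p j x)
        (fun x => by rw [Finset.forall_mem_insert]; tauto), uniformProb_not] at h
    rw [Finset.sum_insert hi]
    linarith

theorem uniformProb_comp_equiv (e : Ω ≃ Ω') (p : Ω' → Prop) :
    uniformProb (fun x => p (e x)) = uniformProb p := by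
  unfold uniformProb
  rw [Nat.card_congr e, Nat.card_congr (e.subtypeEquiv (p := fun x => p (e x)) fun _ => Iff.rfl)]

theorem uniformProb_prod_and (p : Ω → Prop) (q : Ω' → Prop) :
    uniformProb (fun x : Ω × Ω' => p x.1 ∧ q x.2) = uniformProb p * uniformProb q := by
  unfold uniformProb
  rw [Nat.card_congr (Equiv.subtypeProdEquivProd (p := p) (q := q)), Nat.card_prod, Nat.card_prod]
  push_cast
  rw [mul_div_mul_comm]

theorem uniformProb_fst [Finite Ω'] [Nonempty Ω'] (p : Ω → Prop) :
    uniformProb (fun x : Ω × Ω' => p x.1) = uniformProb p := by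
  have := uniformProb_prod_and p fun _ : Ω' => True
  rwa [uniformProb_of_forall fun _ => trivial, mul_one,
    uniformProb_congr (q := fun x : Ω × Ω' => p x.1) fun _ => and_iff_left trivial] at this

/-- Averaging over the first coordinate: fibres over points of `q` contribute at least `c`, all
others at least zero. -/
theorem mul_uniformProb_le_of_fiber [Finite Ω] [Finite Ω'] {q : Ω → Prop} {p : Ω × Ω' → Prop}
    {c : ℝ} (h : ∀ x, q x → c ≤ uniformProb fun y => p (x, y)) :
    c * uniformProb q ≤ uniformProb p := by
  classical
  cases nonempty_fintype Ω
  have e : {z : Ω × Ω' // p z} ≃ Σ x, {y // p (x, y)} :=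
    { toFun := fun z => ⟨z.1.1, z.1.2, z.2⟩
      invFun := fun z => ⟨(z.1, z.2.1), z.2.2⟩
      left_inv := fun _ => rfl
      right_inv := fun _ => rfl }
  have h1 : uniformProb p = (∑ x, uniformProb fun y => p (x, y)) / Nat.card Ω := by
    unfold uniformProb
    rw [Nat.card_congr e, Nat.card_sigma, Nat.card_prod, ← Finset.sum_div, div_div]
    push_cast
    rw [mul_comm (Nat.card Ω : ℝ)]
  have h2 : c * uniformProb q = (∑ x, if q x then c else 0) / Nat.card Ω := by
    unfold uniformProb
    rw [← Finset.sum_filter, Finset.sum_const, nsmul_eq_mul, Nat.card_eq_fintype_card,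
      Fintype.card_subtype]
    ring
  rw [h1, h2]
  gcongr with x
  split_ifs with hx
  · exact h x hx
  · exact uniformProb_nonneg _

/-- A surjective homomorphism of finite groups preserves the uniform distribution. -/
theorem uniformProb_comp_of_surjective {G H : Type*} [AddGroup G] [AddGroup H] [Finite G]
    (φ : G →+ H) (hφ : Function.Surjective φ) (p : H → Prop) :
    uniformProb (fun x => p (φ x)) = uniformProb p := by
  -- A set-theoretic section identifies `G` with `H × φ.ker`, under which `φ` is the first
  -- projection.
  have hσ := Function.surjInv_eq hφ
  let e : G ≃ H × φ.ker :=
    { toFun := fun g => (φ g, ⟨g - Function.surjInv hφ (φ g), by simp [AddMonoidHom.mem_ker, hσ]⟩)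
      invFun := fun x => x.2.1 + Function.surjInv hφ x.1
      left_inv := fun g => by simp
      right_inv := fun x => by
        obtain ⟨x, y, hy⟩ := x
        rw [AddMonoidHom.mem_ker] at hy
        simp [hσ, hy] }
  rw [← uniformProb_fst (Ω' := φ.ker) p, ← uniformProb_comp_equiv e]
  rfl

end UniformProb

/-! ### Resampling and independence of coordinate blocks -/

section Independence

open Classical in
/-- Exchanging the coordinates in `S` between two points of a product type. -/
noncomputable def exchangeOn {E : Type*} (X : E → Type*) (S : Set E) :
    ((∀ e, X e) × (∀ e, X e)) ≃ ((∀ e, X e) × (∀ e, X e)) :=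
  Function.Involutive.toPerm
    (fun x => (S.piecewise x.2 x.1, S.piecewise x.1 x.2)) fun x => by
      ext e <;> by_cases he : e ∈ S <;> simp [he]

variable {E : Type*} {X : E → Type*}

/-- The event `p` depends on the coordinates in `S` only. -/
def DependsOnlyOn (S : Set E) (p : (∀ e, X e) → Prop) : Prop :=
  ∀ x y, (∀ e ∈ S, x e = y e) → (p x ↔ p y)

theorem DependsOnlyOn.mono {S S' : Set E} {p : (∀ e, X e) → Prop} (h : DependsOnlyOn S p)
    (hS : S ⊆ S') : DependsOnlyOn S' p := fun x y hxy => h x y fun e he => hxy e (hS he)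

variable [Finite (∀ e, X e)] [Nonempty (∀ e, X e)]

-- Exchanging the coordinates in `S` is a bijection on pairs of samples, so a sample partly
-- overwritten by an independent one is again uniform.
open Classical in
theorem uniformProb_piecewise (S : Set E) (p : (∀ e, X e) → Prop) :
    uniformProb (fun x : (∀ e, X e) × (∀ e, X e) => p (S.piecewise x.2 x.1)) = uniformProb p := by
  rw [← uniformProb_fst (Ω' := ∀ e, X e) p,
    ← uniformProb_comp_equiv (exchangeOn X S) fun x => p x.1]
  rfl

open Classical in
/-- If, whenever `q` holds, the event `p` has probability at least `c` after resampling of the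
coordinates in `S`, then the probability of `p` is at least `c` times that of `q`. -/
theorem mul_uniformProb_le_of_resample (S : Set E) {p q : (∀ e, X e) → Prop} {c : ℝ}
    (h : ∀ x, q x → c ≤ uniformProb fun y => p (S.piecewise y x)) :
    c * uniformProb q ≤ uniformProb p := by
  rw [← uniformProb_piecewise S p]
  exact mul_uniformProb_le_of_fiber h

theorem uniformProb_and_of_dependsOnlyOn {S : Set E} {p q : (∀ e, X e) → Prop}
    (hp : DependsOnlyOn S p) (hq : DependsOnlyOn Sᶜ q) :
    uniformProb (fun x => p x ∧ q x) = uniformProb p * uniformProb q := by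
  classical
  rw [← uniformProb_piecewise S, mul_comm, ← uniformProb_prod_and]
  refine uniformProb_congr fun x => ?_
  rw [and_comm]
  refine and_congr (hq _ _ fun e he => ?_) (hp _ _ fun e he => ?_)
  · exact Set.piecewise_eq_of_notMem _ _ _ he
  · exact Set.piecewise_eq_of_mem _ _ _ he

/-- Independence of events depending on disjoint blocks of coordinates. -/
theorem uniformProb_forall_and_of_dependsOnlyOn {B : Type*} (φ : E → B) (s : Finset B)
    {p : B → (∀ e, X e) → Prop} {q : (∀ e, X e) → Prop}
    (hp : ∀ b ∈ s, DependsOnlyOn {e | φ e = b} (p b))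
    (hq : DependsOnlyOn {e | φ e ∉ s} q) :
    uniformProb (fun x => (∀ b ∈ s, p b x) ∧ q x) =
      (∏ b ∈ s, uniformProb (p b)) * uniformProb q := by
  classical
  induction s using Finset.induction_on with
  | empty => simp
  | insert b s hb ih =>
    have hq' : DependsOnlyOn {e | φ e ∉ s} q := hq.mono fun e he h => he (Finset.mem_insert_of_mem h)
    rw [Finset.prod_insert hb, mul_assoc,
      ← ih (fun c hc => hp c (Finset.mem_insert_of_mem hc)) hq',
      ← uniformProb_and_of_dependsOnlyOn (hp b (Finset.mem_insert_self b s))]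
    · exact uniformProb_congr fun x => by rw [Finset.forall_mem_insert, and_assoc]
    · intro x y hxy
      refine and_congr (forall₂_congr fun c hc => ?_) (hq x y fun e he => ?_)
      · refine hp c (Finset.mem_insert_of_mem hc) x y fun e he => hxy e ?_
        rintro rfl
        exact hb ((show φ e = c from he).symm ▸ hc)
      · exact hxy e fun h => he (h ▸ Finset.mem_insert_self _ _)

end Independence

/-! ### Random vectors and bases over a finite field -/

section LinearIndependence

theorem one_sub_stepFailure_eq (F : Type*) [Fintype F] (w : ℕ) :
    1 - stepFailure F w = ∏ h ∈ Finset.Icc 1 w, (1 - 1 / (Fintype.card F : ℝ) ^ h) := by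
  rw [stepFailure]; ring

variable {F : Type*} [Field F] [Fintype F]

theorem one_div_card_pow_le_one (h : ℕ) : 1 / (Fintype.card F : ℝ) ^ h ≤ 1 := by
  have : (1 : ℝ) ≤ (Fintype.card F : ℝ) := by exact_mod_cast Fintype.card_pos
  exact div_le_one_of_le₀ (one_le_pow₀ this) (by positivity)

theorem one_sub_stepFailure_nonneg (w : ℕ) : 0 ≤ 1 - stepFailure F w := by
  rw [one_sub_stepFailure_eq]
  exact Finset.prod_nonneg fun h _ => sub_nonneg.2 (one_div_card_pow_le_one h)

theorem one_sub_stepFailure_le_one (w : ℕ) : 1 - stepFailure F w ≤ 1 := by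
  rw [one_sub_stepFailure_eq]
  refine Finset.prod_le_one (fun h _ => sub_nonneg.2 (one_div_card_pow_le_one h)) fun h _ => ?_
  have : (0 : ℝ) ≤ 1 / (Fintype.card F : ℝ) ^ h := by positivity
  linarith

/-- Replacing only `r ≤ w` cut vectors costs no more than replacing all `w`, as every additional
factor is at most one. -/
theorem one_sub_stepFailure_anti {r w : ℕ} (h : r ≤ w) :
    1 - stepFailure F w ≤ 1 - stepFailure F r := by
  rw [one_sub_stepFailure_eq, one_sub_stepFailure_eq]
  refine Finset.prod_le_prod_of_subset_of_le_one (Finset.Icc_subset_Icc_right h)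
    (fun h _ => sub_nonneg.2 (one_div_card_pow_le_one h)) fun h _ _ => ?_
  have : (0 : ℝ) ≤ 1 / (Fintype.card F : ℝ) ^ h := by positivity
  linarith

/-- The probability that a uniformly random family in a space of the same dimension is a basis. -/
theorem uniformProb_linearIndependent {ι Q : Type*} [Fintype ι] [AddCommGroup Q] [Module F Q]
    [Module.Finite F Q] (h : Module.finrank F Q = Fintype.card ι) :
    uniformProb (fun x : ι → Q => LinearIndependent F x) = 1 - stepFailure F (Fintype.card ι) := by
  have : Finite Q := Module.finite_of_finite F
  have hq : (Fintype.card F : ℝ) ≠ 0 := by exact_mod_cast Fintype.card_ne_zero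
  rw [← uniformProb_comp_equiv (Equiv.arrowCongr (Fintype.equivFin ι).symm (Equiv.refl Q))]
  set r := Fintype.card ι
  have h1 : uniformProb (fun x : Fin r → Q => LinearIndependent F
      ((Equiv.arrowCongr (Fintype.equivFin ι).symm (Equiv.refl Q)) x)) =
      uniformProb (fun x : Fin r → Q => LinearIndependent F x) :=
    uniformProb_congr fun x => linearIndependent_equiv (Fintype.equivFin ι)
  rw [h1, uniformProb, card_linearIndependent h.ge, one_sub_stepFailure_eq, Nat.card_fun,
    Nat.card_eq_fintype_card (α := Fin r), Fintype.card_fin, Module.natCard_eq_pow_finrank (K := F),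
    h, Nat.card_eq_fintype_card (α := F)]
  -- The count is $\prod_i (q^r-q^i)$; dividing by $q^r$ gives factors $1-q^{-(r-i)}$, matched with
  -- the exponents $1,\dots,r$ by $i\mapsto r-i$.
  have h2 : ∏ i ∈ Finset.Icc 1 r, (1 - 1 / (Fintype.card F : ℝ) ^ i) =
      ∏ i : Fin r, (1 - 1 / (Fintype.card F : ℝ) ^ (r - i.val)) := by
    rw [Fin.prod_univ_eq_prod_range (fun i => 1 - 1 / (Fintype.card F : ℝ) ^ (r - i)) r]
    refine (Finset.prod_nbij' (fun i => r - i) (fun i => r - i) ?_ ?_ ?_ ?_ ?_).symm <;>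
      simp only [Finset.mem_range, Finset.mem_Icc] <;> intros <;> first | omega | trivial
  rw [h2]
  push_cast
  rw [show ((Fintype.card F : ℝ) ^ r) ^ r = ∏ _i : Fin r, (Fintype.card F : ℝ) ^ r by simp,
    ← Finset.prod_div_distrib]
  refine Finset.prod_congr rfl fun i _ => ?_
  rw [Nat.cast_sub (Nat.pow_le_pow_right Fintype.card_pos i.2.le)]
  push_cast
  rw [sub_div, div_self (pow_ne_zero _ hq), pow_sub₀ _ hq i.2.le]
  field_simp

open Classical in
/-- In a basis `u`, replace the vectors with index in `J` by random linear combinations of vectors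
`v d` among which are all the replaced ones. The result is a basis with probability at least
`1 - stepFailure F w`. -/
theorem one_sub_stepFailure_le_uniformProb_replace {w : ℕ} {D : Type*} [Fintype D]
    {u : Fin w → Fin w → F} (hu : LinearIndependent F u) (J : Set (Fin w)) (v : D → Fin w → F)
    (hv : ∀ j ∈ J, ∃ d, v d = u j) :
    1 - stepFailure F w ≤ uniformProb fun L : J → D → F =>
      LinearIndependent F fun j => if hj : j ∈ J then ∑ d, L ⟨j, hj⟩ d • v d else u j := by
  set W := Submodule.span F (u '' Jᶜ)
  have hspan : Submodule.span F (Set.range u) = ⊤ :=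
    hu.span_eq_top_of_card_eq_finrank' (by simp)
  -- The basis `u` spans the quotient by `W`; its vectors outside `J` vanish there, and those in `J`
  -- occur among the `v d`.
  have hspanQ : Submodule.span F (Set.range fun d => W.mkQ (v d)) = ⊤ := by
    rw [eq_top_iff, ← Submodule.range_mkQ W, LinearMap.range_eq_map, ← hspan, Submodule.map_span,
      Submodule.span_le]
    rintro _ ⟨_, ⟨j, rfl⟩, rfl⟩
    by_cases hj : j ∈ J
    · obtain ⟨d, hd⟩ := hv j hj
      exact Submodule.subset_span ⟨d, congrArg _ hd⟩
    · have : W.mkQ (u j) = 0 := by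
        rw [Submodule.mkQ_apply, Submodule.Quotient.mk_eq_zero]
        exact Submodule.subset_span ⟨j, hj, rfl⟩
      rw [this]
      exact Submodule.zero_mem _
  have hW : LinearIndepOn F u Jᶜ := hu.linearIndepOn _
  let φ : (J → D → F) →+ (J → (Fin w → F) ⧸ W) :=
    { toFun := fun L j => ∑ d, L j d • W.mkQ (v d)
      map_zero' := by ext; simp
      map_add' := fun L L' => by ext; simp [add_smul, Finset.sum_add_distrib] }
  have hφ : Function.Surjective φ := by
    intro y
    have (j : J) : ∃ c : D → F, ∑ d, c d • W.mkQ (v d) = y j :=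
      (Submodule.mem_span_range_iff_exists_fun F).1 (hspanQ ▸ Submodule.mem_top)
    choose c hc using this
    exact ⟨c, funext hc⟩
  have hrank : Module.finrank F ((Fin w → F) ⧸ W) = Fintype.card J := by
    have h1 := Submodule.finrank_quotient_add_finrank W
    have h2 : Module.finrank F W = Fintype.card (Jᶜ : Set (Fin w)) := by
      have := finrank_span_eq_card hW.linearIndependent
      rwa [← Set.image_eq_range] at this
    rw [h2, Module.finrank_fin_fun] at h1
    have h3 := Fintype.card_compl_set J
    have h4 := set_fintype_card_le_univ J
    rw [Fintype.card_fin] at h3 h4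
    omega
  -- The vectors outside `J` are unchanged and independent, so only independence of the new ones
  -- modulo `W` matters.
  have key : ∀ L : J → D → F, (LinearIndependent F fun j =>
      if hj : j ∈ J then ∑ d, L ⟨j, hj⟩ d • v d else u j) ↔ LinearIndependent F (φ L) := by
    intro L
    set g : Fin w → Fin w → F := fun j => if hj : j ∈ J then ∑ d, L ⟨j, hj⟩ d • v d else u j
    have hg : Set.EqOn g u Jᶜ := fun j hj => dif_neg hj
    have hgW : Submodule.span F (g '' Jᶜ) = W := by rw [hg.image_eq]
    rw [← linearIndepOn_univ_iff, ← Set.compl_union_self J,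
      linearIndepOn_union_iff_quotient disjoint_compl_left, hgW, linearIndepOn_congr hg,
      and_iff_right hW]
    have : (fun j : J => W.mkQ (g j)) = φ L := by
      ext1 j
      simp [g, φ, j.2]
    rw [← this]
    rfl
  rw [uniformProb_congr key, uniformProb_comp_of_surjective φ hφ fun y => LinearIndependent F y,
    uniformProb_linearIndependent hrank]
  refine one_sub_stepFailure_anti ?_
  simpa using set_fintype_card_le_univ J

end LinearIndependence

namespace Network

/-! ### Directed paths -/

section Paths

variable {V E : Type*} {N : Network V E} {x y : V} {p p₁ p₂ : List E} {e : E}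

theorem IsPath.pairwise (h : N.IsPath x y p) :
    p.Pairwise fun d e => Relation.TransGen N.Adj (N.tail d) (N.tail e) := by
  have : IsTrans E fun d e => Relation.TransGen N.Adj (N.tail d) (N.tail e) :=
    ⟨fun _ _ _ => Relation.TransGen.trans⟩
  refine List.IsChain.pairwise (h.1.imp fun d e hde => ?_)
  exact .single ⟨d, rfl, hde⟩

theorem IsPath.ne_nil (h : N.IsPath x y p) : p ≠ [] := by
  rintro rfl
  simpa using h.2.1

theorem IsPath.source_or_pred (h : N.IsPath x y (p₁ ++ e :: p₂)) :
    (p₁ = [] ∧ N.tail e = x) ∨ ∃ d, p₁.getLast? = some d ∧ N.head d = N.tail e := by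
  rcases p₁.eq_nil_or_concat with rfl | ⟨q, d, rfl⟩
  · left
    simpa using h.2.1
  · right
    refine ⟨d, by simp, ?_⟩
    have := h.1
    rw [List.concat_eq_append, List.append_assoc] at this
    have := this.right_of_append
    simp at this
    exact this.1

theorem IsPath.target_or_succ (h : N.IsPath x y (p₁ ++ e :: p₂)) :
    (p₂ = [] ∧ N.head e = y) ∨ ∃ d ∈ p₂, N.head e = N.tail d := by
  cases p₂ with
  | nil => left; simpa using h.2.2
  | cons d q =>
    right
    have := h.1.right_of_append
    simp at this
    exact ⟨d, by simp, this.1⟩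

/-- The channels of a path other than the last one lead to the tail of a later channel. -/
theorem IsPath.head_eq_or (h : N.IsPath x y p) (he : e ∈ p) :
    N.head e = y ∨ ∃ d ∈ p, N.head e = N.tail d ∧
      Relation.TransGen N.Adj (N.tail e) (N.tail d) := by
  obtain ⟨p₁, p₂, rfl⟩ := List.append_of_mem he
  rcases h.target_or_succ with ⟨-, h⟩ | ⟨d, hd, h⟩
  · exact .inl h
  · exact .inr ⟨d, by simp [hd], h, .single ⟨e, rfl, h⟩⟩

theorem IsPath.exists_tail_eq (h : N.IsPath x y p) : ∃ e ∈ p, N.tail e = x := by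
  cases p with
  | nil => exact absurd rfl h.ne_nil
  | cons e q => exact ⟨e, by simp, by simpa using h.2.1⟩

end Paths

/-! ### Kernels under resampling at one node -/

section Kernels

variable {V E : Type*} [Fintype E] {N : Network V E} {F : Type*} [Field F] {w : ℕ}

/-- The global encoding kernels of the real and the imaginary channels. -/
noncomputable def kernelExt (K : N.Coeff F w) : Fin w ⊕ E → Fin w → F :=
  Sum.elim (fun i => Pi.single i 1) (N.kernel K)

theorem kernel_eq_sum (K : N.Coeff F w) (e : E)
    [Fintype {d : Fin w ⊕ E // N.headExt d = N.tail e}] :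
    N.kernel K e = ∑ d : {d : Fin w ⊕ E // N.headExt d = N.tail e}, K e d • kernelExt K d.1 := by
  rw [N.kernel_eq]
  congr!

/-- The kernel of a channel only depends on the coefficients of the channels upstream. -/
theorem kernel_congr {K K' : N.Coeff F w} (e : E)
    (h : ∀ d, Relation.ReflTransGen N.Adj (N.tail d) (N.tail e) → K d = K' d) :
    N.kernel K e = N.kernel K' e := by
  classical
  induction e using N.wellFounded_channels.induction with
  | _ e ih =>
    rw [kernel_eq_sum, kernel_eq_sum, h e .refl]
    refine Finset.sum_congr rfl fun d _ => ?_
    rcases d with ⟨i | d, hd⟩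
    · rfl
    · have : N.kernel K d = N.kernel K' d :=
        ih d hd fun c hc => h c (hc.tail ⟨d, rfl, hd⟩)
      simp [kernelExt, this]

open Classical in
theorem kernelExt_piecewise_of_not_reachable {v : V} (K L : N.Coeff F w) {c : Fin w ⊕ E}
    (hc : ∀ e, c = Sum.inr e → ¬ Relation.ReflTransGen N.Adj v (N.tail e)) :
    kernelExt ({e | N.tail e = v}.piecewise L K : N.Coeff F w) c = kernelExt K c := by
  rcases c with i | e
  · rfl
  · refine kernel_congr e fun d hd => Set.piecewise_eq_of_notMem _ _ _ fun h => ?_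
    rw [show N.tail d = v from h] at hd
    exact hc e rfl hd

-- By acyclicity no channel entering `v` lies downstream of `v`, so the resampling leaves the
-- incoming kernels as they were under `K`.
open Classical in
theorem kernel_piecewise_of_tail_eq {v : V} (K L : N.Coeff F w) {e : E} (he : N.tail e = v) :
    N.kernel ({e | N.tail e = v}.piecewise L K : N.Coeff F w) e =
      ∑ d : {d : Fin w ⊕ E // N.headExt d = v}, L e ⟨d.1, d.2.trans he.symm⟩ • kernelExt K d.1 := by
  subst he
  rw [kernel_eq_sum]
  refine Finset.sum_congr rfl fun d _ => ?_
  rw [Set.piecewise_eq_of_mem _ _ _ (show e ∈ {e' | N.tail e' = N.tail e} from rfl),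
    kernelExt_piecewise_of_not_reachable]
  rintro c hc h
  refine N.acyclic (N.tail e) (Relation.TransGen.tail' h ⟨c, rfl, ?_⟩)
  rw [← d.2, hc]
  rfl

open Classical in
/-- The failure probability in terms of `uniformProb`. -/
theorem failureProb_eq (N : Network V E) (F : Type*) [Field F] [Fintype F] (w : ℕ) :
    N.failureProb F w = 1 - uniformProb fun K : N.Coeff F w =>
      ∀ t ∈ N.sinks, ¬ (N.decodingMatrix K t).rank < w := by
  rw [← uniformProb_not, failureProb, PMF.toOuterMeasure_uniformOfFintype_apply, uniformProb,
    ENNReal.toReal_div, ENNReal.toReal_natCast, ENNReal.toReal_natCast,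
    ← Nat.card_eq_fintype_card, ← Nat.card_eq_fintype_card]
  congr 2
  refine congrArg Nat.cast (Nat.card_congr (Equiv.subtypeEquivRight fun K => ?_))
  simp

end Kernels

/-! ### Cuts along the chosen paths -/

namespace ChosenPaths

variable {V E : Type*} {N : Network V E} {w R : ℕ} (P : N.ChosenPaths w R)

theorem exists_node_eq_tail {t : V} (ht : t ∈ N.sinks) {j : Fin w} {e : E} (he : e ∈ P.path t j) :
    ∃ k, P.node k = N.tail e := by
  by_cases h : N.tail e = N.source
  · exact ⟨0, P.node_zero.trans h.symm⟩
  · have : N.tail e ∈ Set.range fun k : Fin R => P.node k.succ := by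
      rw [P.range_node]
      exact ⟨h, t, ht, j, e, he, rfl⟩
    obtain ⟨k, hk⟩ := this
    exact ⟨k.succ, hk⟩

open Classical in
/-- The last channel of the path with index `j` to `t` whose tail is one of the first `k` of the
nodes `i_0, …, i_R`, or the imaginary channel with index `j` if there is none. -/
noncomputable def cut (t : V) (k : ℕ) (j : Fin w) : Fin w ⊕ E :=
  ((P.path t j).filter fun e => ∃ k' : Fin (R + 1), k'.val < k ∧ P.node k' = N.tail e).getLast?.elim
    (Sum.inl j) Sum.inr

theorem cut_zero (t : V) (j : Fin w) : P.cut t 0 j = Sum.inl j := by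
  simp [cut]

theorem tail_of_cut_eq_inr {t : V} {k : ℕ} {j : Fin w} {e : E} (h : P.cut t k j = Sum.inr e) :
    ∃ k' : Fin (R + 1), k'.val < k ∧ P.node k' = N.tail e := by
  classical
  rw [cut] at h
  cases h' : ((P.path t j).filter fun e =>
    ∃ k' : Fin (R + 1), k'.val < k ∧ P.node k' = N.tail e).getLast? with
  | none => rw [h'] at h; simp at h
  | some d =>
    rw [h'] at h
    obtain rfl : d = e := by simpa using h
    have := List.mem_of_getLast? h'
    simpa using (List.mem_filter.1 this).2

theorem cut_succ_of_forall_ne {t : V} {k : Fin (R + 1)} {j : Fin w}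
    (h : ∀ e ∈ P.path t j, N.tail e ≠ P.node k) : P.cut t (k + 1) j = P.cut t k j := by
  classical
  rw [cut, cut]
  congr 2
  refine List.filter_congr fun e he => ?_
  rw [decide_eq_decide]
  refine exists_congr fun k' => and_congr_left fun hk' => ?_
  have : k' ≠ k := by
    rintro rfl
    exact h e he hk'.symm
  have := Fin.val_ne_of_ne this
  omega

/-- Topological order splits the path at `e`: earlier channels have tails of index below `k`, later
ones above `k`. Hence the cut moves from the predecessor of `e`, which enters `i_k`, to `e` itself.
If `e` comes first, the predecessor is an imaginary channel and `i_k` is the source. -/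
theorem cut_succ_of_mem {t : V} (ht : t ∈ N.sinks) {k : Fin (R + 1)} {j : Fin w} {e : E}
    (he : e ∈ P.path t j) (hk : N.tail e = P.node k) :
    P.cut t (k + 1) j = Sum.inr e ∧ N.headExt (P.cut t k j) = P.node k := by
  classical
  have hp := P.isPath t ht j
  have hmem : ∀ d ∈ P.path t j, ∃ k', P.node k' = N.tail d := fun d hd =>
    P.exists_node_eq_tail ht hd
  rw [cut, cut]
  generalize P.path t j = p at he hp hmem
  obtain ⟨p₁, p₂, rfl⟩ := List.append_of_mem he
  have hpw := List.pairwise_append.1 hp.pairwise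
  have h₁ : ∀ d ∈ p₁, ∃ k' : Fin (R + 1), k' < k ∧ P.node k' = N.tail d := by
    intro d hd
    obtain ⟨k', hk'⟩ := hmem d (by simp [hd])
    refine ⟨k', P.topological _ _ ?_, hk'⟩
    rw [hk', ← hk]
    exact hpw.2.2 d hd e (by simp)
  have h₂ : ∀ d ∈ p₂, ∀ k' : Fin (R + 1), P.node k' = N.tail d → k < k' := by
    intro d hd k' hk'
    refine P.topological _ _ ?_
    rw [hk', ← hk]
    exact (List.pairwise_cons.1 hpw.2.1).1 d hd
  have hself : ∀ k' : Fin (R + 1), P.node k' = N.tail e → k' = k := fun k' hk' =>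
    P.node_injective (hk'.trans hk)
  have hfilter₁ : ∀ n : ℕ, k.val ≤ n →
      p₁.filter (fun d => ∃ k' : Fin (R + 1), k'.val < n ∧ P.node k' = N.tail d) = p₁ := by
    intro n hn
    refine List.filter_eq_self.2 fun d hd => decide_eq_true ?_
    obtain ⟨k', hk', h⟩ := h₁ d hd
    exact ⟨k', lt_of_lt_of_le hk' hn, h⟩
  have hfilter₂ : ∀ n : ℕ, n ≤ k.val + 1 →
      p₂.filter (fun d => ∃ k' : Fin (R + 1), k'.val < n ∧ P.node k' = N.tail d) = [] := by
    intro n hn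
    refine List.filter_eq_nil_iff.2 fun d hd => ?_
    rw [decide_eq_true_iff]
    rintro ⟨k', hk', h⟩
    have := Fin.lt_def.1 (h₂ d hd k' h)
    omega
  constructor
  · rw [List.filter_append, hfilter₁ _ (Nat.le_succ _), List.filter_cons_of_pos,
      hfilter₂ _ le_rfl]
    · simp
    · exact decide_eq_true ⟨k, Nat.lt_succ_self _, hk.symm⟩
  · rw [List.filter_append, hfilter₁ _ le_rfl, List.filter_cons_of_neg,
      hfilter₂ _ (Nat.le_succ _), List.append_nil]
    · rcases hp.source_or_pred with ⟨rfl, h⟩ | ⟨d, hd, h⟩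
      · rw [← hk, h]
        rfl
      · rw [hd, ← hk, ← h]
        rfl
    · rw [decide_eq_true_iff]
      rintro ⟨k', hk', h⟩
      rw [hself k' h] at hk'
      exact lt_irrefl _ hk'

theorem exists_cut_last {t : V} (ht : t ∈ N.sinks) (j : Fin w) :
    ∃ e, P.cut t (R + 1) j = Sum.inr e ∧ N.head e = t := by
  classical
  have hp := P.isPath t ht j
  have : (P.path t j).filter (fun e => ∃ k' : Fin (R + 1), k'.val < R + 1 ∧ P.node k' = N.tail e) =
      P.path t j := by
    refine List.filter_eq_self.2 fun d hd => decide_eq_true ?_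
    obtain ⟨k', h⟩ := P.exists_node_eq_tail ht hd
    exact ⟨k', k'.2, h⟩
  rw [cut, this]
  obtain ⟨e, he, h⟩ := Option.map_eq_some_iff.1 hp.2.2
  exact ⟨e, by rw [he]; rfl, h⟩

theorem mem_M {k : Fin (R + 1)} {t : V} :
    t ∈ P.M k ↔ t ∈ N.sinks ∧ ∃ j, ∃ e ∈ P.path t j, N.tail e = P.node k := by
  simp [M]

theorem mem_lastM {k : Fin (R + 1)} {t : V} :
    t ∈ P.lastM k ↔ t ∈ P.M k ∧ ∀ k', k < k' → t ∉ P.M k' := by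
  simp [lastM]

theorem lastM_subset_M (k : Fin (R + 1)) : P.lastM k ⊆ P.M k := fun _ h => (P.mem_lastM.1 h).1

theorem excess_eq [DecidableEq V] (k : Fin (R + 1)) : P.excess k = ((P.M k \ P.lastM k).card : ℝ) := by
  rw [excess, Finset.card_sdiff_of_subset (P.lastM_subset_M k),
    Nat.cast_sub (Finset.card_le_card (P.lastM_subset_M k))]

theorem excess_last : P.excess (Fin.last R) = 0 := by
  have : P.lastM (Fin.last R) = P.M (Fin.last R) :=
    (P.lastM_subset_M _).antisymm fun t ht =>
      P.mem_lastM.2 ⟨ht, fun k' hk' => absurd hk' (Fin.le_last k').not_gt⟩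
  rw [excess, this, sub_self]

/-- A sink has at most one last node, so these sets are pairwise disjoint. -/
theorem sum_card_lastM_le : ∑ k, (P.lastM k).card ≤ N.sinks.card := by
  classical
  rw [← Finset.card_biUnion]
  · refine Finset.card_le_card (Finset.biUnion_subset.2 fun k _ t ht => ?_)
    exact (P.mem_M.1 (P.lastM_subset_M k ht)).1
  · intro k _ k' _ hkk'
    rw [Function.onFun, Finset.disjoint_left]
    intro t ht ht'
    rw [mem_lastM] at ht ht'
    rcases lt_or_gt_of_ne hkk' with h | h
    · exact ht.2 _ h ht'.1
    · exact ht'.2 _ h ht.1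

/-- If the channel did not enter `t`, the path would continue through some $i_{k'}$ with $k'>k$. -/
theorem head_eq_of_mem_lastM {k : Fin (R + 1)} {t : V} (ht : t ∈ P.lastM k) {j : Fin w} {e : E}
    (he : e ∈ P.path t j) (hk : N.tail e = P.node k) : N.head e = t := by
  rw [mem_lastM, mem_M] at ht
  rcases (P.isPath t ht.1.1 j).head_eq_or he with h | ⟨d, hd, -, h⟩
  · exact h
  · obtain ⟨k', hk'⟩ := P.exists_node_eq_tail ht.1.1 hd
    rw [hk, ← hk'] at h
    exact absurd (P.mem_M.2 ⟨ht.1.1, j, d, hd, hk'.symm⟩) (ht.2 k' (P.topological _ _ h))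

theorem head_eq_or_notMem_sinks {t : V} (ht : t ∈ N.sinks) {j : Fin w} {e : E}
    (he : e ∈ P.path t j) : N.head e = t ∨ N.head e ∉ N.sinks := by
  rcases (P.isPath t ht j).head_eq_or he with h | ⟨d, hd, h, -⟩
  · exact .inl h
  · exact .inr (h ▸ P.tail_notMem_sinks t ht j d hd)

/-- The channel with tail `i_k` of a path through `i_k`. -/
noncomputable def outChannel {t : V} {k : Fin (R + 1)} {j : Fin w}
    (h : ∃ e ∈ P.path t j, N.tail e = P.node k) : E := h.choose

theorem outChannel_mem {t : V} {k : Fin (R + 1)} {j : Fin w}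
    (h : ∃ e ∈ P.path t j, N.tail e = P.node k) : P.outChannel h ∈ P.path t j := h.choose_spec.1

theorem tail_outChannel {t : V} {k : Fin (R + 1)} {j : Fin w}
    (h : ∃ e ∈ P.path t j, N.tail e = P.node k) : N.tail (P.outChannel h) = P.node k :=
  h.choose_spec.2

/-! ### Stage-by-stage estimate -/

section Stages

variable [Fintype E] {F : Type*} [Field F]

/-- The kernels of the channels of the cut of stage `k` for the sink `t` are linearly
independent. -/
def CutIndep (K : N.Coeff F w) (k : ℕ) (t : V) : Prop :=
  LinearIndependent F fun j => kernelExt K (P.cut t k j)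

theorem cutIndep_zero (K : N.Coeff F w) (t : V) : P.CutIndep K 0 t := by
  have : (fun j => kernelExt K (P.cut t 0 j)) = fun j => (Pi.single j 1 : Fin w → F) := by
    ext1 j
    rw [cut_zero]
    rfl
  rw [CutIndep, this]
  exact Pi.linearIndependent_single_one (Fin w) F

open Classical in
theorem not_rank_lt_of_cutIndep {K : N.Coeff F w} {t : V} (ht : t ∈ N.sinks)
    (h : P.CutIndep K (R + 1) t) : ¬ (N.decodingMatrix K t).rank < w := by
  choose e he het using P.exists_cut_last ht
  have h' : LinearIndependent F fun j => N.kernel K (e j) := by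
    rw [CutIndep] at h
    simp only [he] at h
    exact h
  have h1 := finrank_span_eq_card h'
  rw [Fintype.card_fin] at h1
  rw [not_lt, Matrix.rank_eq_finrank_span_cols]
  refine h1.symm.trans_le (Submodule.finrank_mono (Submodule.span_mono ?_))
  rintro _ ⟨j, rfl⟩
  exact ⟨⟨e j, het j⟩, rfl⟩

-- One resampling step for the cut: entries on paths through `i_k` become random combinations of the
-- kernels entering `i_k`. All other entries are imaginary or leave an earlier node, hence are not
-- downstream of `i_k`.
open Classical in
theorem kernelExt_piecewise_cut (K L : N.Coeff F w) {t : V} (ht : t ∈ N.sinks) (k : Fin (R + 1))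
    (j : Fin w) :
    kernelExt ({e | N.tail e = P.node k}.piecewise L K : N.Coeff F w) (P.cut t (k + 1) j) =
      if h : ∃ e ∈ P.path t j, N.tail e = P.node k then
        ∑ d : {d : Fin w ⊕ E // N.headExt d = P.node k},
          L (P.outChannel h) ⟨d.1, d.2.trans (P.tail_outChannel h).symm⟩ • kernelExt K d.1
      else kernelExt K (P.cut t k j) := by
  split_ifs with h
  · rw [(P.cut_succ_of_mem ht (P.outChannel_mem h) (P.tail_outChannel h)).1]
    exact kernel_piecewise_of_tail_eq K L (P.tail_outChannel h)
  · rw [P.cut_succ_of_forall_ne fun e he hk => h ⟨e, he, hk⟩]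
    refine kernelExt_piecewise_of_not_reachable K L fun e he hr => ?_
    obtain ⟨k', hk', h'⟩ := P.tail_of_cut_eq_inr he
    rw [← h'] at hr
    rcases Relation.reflTransGen_iff_eq_or_transGen.1 hr with h | h
    · rw [P.node_injective h] at hk'
      exact lt_irrefl _ hk'
    · exact lt_asymm hk' (P.topological _ _ h)

open Classical in
theorem dependsOnlyOn_cutIndep (K : N.Coeff F w) {t : V} (ht : t ∈ N.sinks) (k : Fin (R + 1))
    {S : Set E} (hS : ∀ j, ∀ e ∈ P.path t j, N.tail e = P.node k → e ∈ S) :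
    DependsOnlyOn S fun L : N.Coeff F w =>
      P.CutIndep ({e | N.tail e = P.node k}.piecewise L K : N.Coeff F w) (k + 1) t := by
  intro L L' hL
  simp only [CutIndep, P.kernelExt_piecewise_cut K _ ht]
  have : ∀ (j : Fin w) (h : ∃ e ∈ P.path t j, N.tail e = P.node k),
      L (P.outChannel h) = L' (P.outChannel h) := fun j h =>
    hL _ (hS j _ (P.outChannel_mem h) (P.tail_outChannel h))
  simp only [this]

open Classical in
theorem cutIndep_piecewise_of_notMem_M {K : N.Coeff F w} (L : N.Coeff F w) {t : V}
    (ht : t ∈ N.sinks) {k : Fin (R + 1)} (hK : P.CutIndep K k t) (h : t ∉ P.M k) :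
    P.CutIndep ({e | N.tail e = P.node k}.piecewise L K : N.Coeff F w) (k + 1) t := by
  rw [mem_M] at h
  have : ∀ j, ¬ ∃ e ∈ P.path t j, N.tail e = P.node k := fun j hj => h ⟨ht, j, hj⟩
  simp only [CutIndep, P.kernelExt_piecewise_cut K _ ht, this, dite_false]
  exact hK

variable [Fintype F]

open Classical in
theorem one_sub_stepFailure_le_uniformProb_cutIndep {K : N.Coeff F w} {t : V}
    (ht : t ∈ N.sinks) {k : Fin (R + 1)} (hK : P.CutIndep K k t) :
    1 - stepFailure F w ≤ uniformProb fun L : N.Coeff F w =>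
      P.CutIndep ({e | N.tail e = P.node k}.piecewise L K : N.Coeff F w) (k + 1) t := by
  let J : Set (Fin w) := {j | ∃ e ∈ P.path t j, N.tail e = P.node k}
  let D := {d : Fin w ⊕ E // N.headExt d = P.node k}
  let φ : N.Coeff F w →+ (J → D → F) :=
    { toFun := fun L j d => L (P.outChannel j.2) ⟨d.1, d.2.trans (P.tail_outChannel j.2).symm⟩
      map_zero' := rfl
      map_add' := fun _ _ => rfl }
  -- Coefficients can be prescribed separately for each path because the paths to one sink are
  -- channel-disjoint, so `outChannel` is injective in the path index.
  have hφ : Function.Surjective φ := by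
    intro y
    refine ⟨fun e d => if h : ∃ j : J, P.outChannel j.2 = e then
      y h.choose ⟨d.1, d.2.trans ((congrArg N.tail h.choose_spec.symm).trans
        (P.tail_outChannel h.choose.2))⟩ else 0, ?_⟩
    ext j d
    have h : ∃ j' : J, P.outChannel j'.2 = P.outChannel j.2 := ⟨j, rfl⟩
    have hj : h.choose = j := by
      by_contra hne
      refine P.disjoint t ht _ _ (fun h' => hne (Subtype.ext h'))
        (P.outChannel_mem h.choose.2) ?_
      rw [h.choose_spec]
      exact P.outChannel_mem j.2
    simp only [φ, AddMonoidHom.coe_mk, ZeroHom.coe_mk, dif_pos h]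
    exact congrFun (congrArg y hj) d
  have key := one_sub_stepFailure_le_uniformProb_replace hK J (fun d : D => kernelExt K d.1)
    fun j hj => by
      obtain ⟨e, he, hk⟩ := hj
      exact ⟨⟨P.cut t k j, (P.cut_succ_of_mem ht he hk).2⟩, rfl⟩
  rw [← uniformProb_comp_of_surjective φ hφ] at key
  refine key.trans_eq (uniformProb_congr fun L => ?_)
  simp only [CutIndep, P.kernelExt_piecewise_cut K _ ht]
  refine iff_of_eq ?_
  congr 1
  ext1 j
  by_cases hj : ∃ e ∈ P.path t j, N.tail e = P.node k
  · rw [dif_pos hj, dif_pos (show j ∈ J from hj)]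
    rfl
  · rw [dif_neg hj, dif_neg (show j ∉ J from hj)]

-- Only channels leaving `i_k` are resampled. Sinks in `lastM` are handled by independence, the rest
-- of `M` by the union bound.
open Classical in
theorem le_uniformProb_forall_cutIndep {K : N.Coeff F w} {k : Fin (R + 1)}
    (hK : ∀ t ∈ N.sinks, P.CutIndep K k t) (hnonneg : P.excess k * stepFailure F w ≤ 1) :
    (1 - stepFailure F w) ^ (P.lastM k).card * (1 - P.excess k * stepFailure F w) ≤
      uniformProb fun L : N.Coeff F w => ∀ t ∈ N.sinks,
        P.CutIndep ({e | N.tail e = P.node k}.piecewise L K : N.Coeff F w) (k + 1) t := by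
  set G : V → N.Coeff F w → Prop := fun t L =>
    P.CutIndep ({e | N.tail e = P.node k}.piecewise L K : N.Coeff F w) (k + 1) t
  have hM : ∀ t ∈ P.M k, t ∈ N.sinks := fun t ht => (P.mem_M.1 ht).1
  have hG : ∀ t ∈ P.M k, 1 - stepFailure F w ≤ uniformProb (G t) := fun t ht =>
    P.one_sub_stepFailure_le_uniformProb_cutIndep (hM t ht) (hK t (hM t ht))
  -- Channels are grouped by their head. A sink of `lastM` uses only channels entering itself; any
  -- other sink uses channels entering itself or a non-sink, since chosen paths have no sink in
  -- their interior.
  have hindep := uniformProb_forall_and_of_dependsOnlyOn N.head (P.lastM k) (p := G)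
    (q := fun L => ∀ t ∈ P.M k \ P.lastM k, G t L)
    (fun t ht => P.dependsOnlyOn_cutIndep K (hM t (P.lastM_subset_M k ht)) k
      fun j e he hk => P.head_eq_of_mem_lastM ht he hk)
    (fun L L' hL => forall₂_congr fun t ht => by
      rw [Finset.mem_sdiff] at ht
      refine P.dependsOnlyOn_cutIndep K (hM t ht.1) k (S := {e | N.head e ∉ P.lastM k}) ?_ L L' hL
      intro j e he hk hlast
      rcases P.head_eq_or_notMem_sinks (hM t ht.1) he with h | h
      · exact ht.2 (h ▸ hlast)
      · exact h (hM _ (P.lastM_subset_M k hlast)))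
  calc _ ≤ (∏ t ∈ P.lastM k, uniformProb (G t)) *
        uniformProb fun L => ∀ t ∈ P.M k \ P.lastM k, G t L := by
        refine mul_le_mul ?_ ?_ (sub_nonneg.2 hnonneg)
          (Finset.prod_nonneg fun t _ => uniformProb_nonneg _)
        · rw [← Finset.prod_const]
          exact Finset.prod_le_prod (fun _ _ => one_sub_stepFailure_nonneg w)
            fun t ht => hG t (P.lastM_subset_M k ht)
        · refine le_trans ?_ (one_sub_sum_le_uniformProb _ _)
          rw [P.excess_eq, ← nsmul_eq_mul, ← Finset.sum_const]
          refine sub_le_sub_left (Finset.sum_le_sum fun t ht => ?_) _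
          have := hG t (Finset.mem_sdiff.1 ht).1
          linarith
    _ = _ := hindep.symm
    _ ≤ _ := by
      refine uniformProb_mono fun L hL t ht => ?_
      by_cases htM : t ∈ P.M k
      · by_cases htl : t ∈ P.lastM k
        · exact hL.1 t htl
        · exact hL.2 t (Finset.mem_sdiff.2 ⟨htM, htl⟩)
      · exact P.cutIndep_piecewise_of_notMem_M L ht (hK t ht) htM

/-- The upper bound on the failure probability. -/
theorem failureProb_le_bound (h : ∀ k : Fin R, P.excess k.castSucc * stepFailure F w ≤ 1) :
    N.failureProb F w ≤ P.bound F := by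
  classical
  have h' : ∀ k, P.excess k * stepFailure F w ≤ 1 := fun k => by
    induction k using Fin.lastCases with
    | last => rw [excess_last, zero_mul]; exact zero_le_one
    | cast k => exact h k
  let c : Fin (R + 1) → ℝ := fun k =>
    (1 - stepFailure F w) ^ (P.lastM k).card * (1 - P.excess k * stepFailure F w)
  have hc : ∀ k, 0 ≤ c k := fun k =>
    mul_nonneg (pow_nonneg (one_sub_stepFailure_nonneg w) _) (sub_nonneg.2 (h' k))
  -- Nonnegativity of the factors `c k` is what allows the conditional estimates to be multiplied.
  have stage : ∀ n : ℕ, n ≤ R + 1 → (∏ k : Fin (R + 1), if k.val < n then c k else 1) ≤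
      uniformProb fun K : N.Coeff F w => ∀ t ∈ N.sinks, P.CutIndep K n t := by
    intro n
    induction n with
    | zero =>
      intro _
      rw [uniformProb_of_forall fun K t _ => P.cutIndep_zero K t]
      simp
    | succ n ih =>
      intro hn
      let k : Fin (R + 1) := ⟨n, hn⟩
      have hprod : (∏ k : Fin (R + 1), if k.val < n + 1 then c k else 1) =
          c k * ∏ k : Fin (R + 1), if k.val < n then c k else 1 := by
        rw [← Finset.mul_prod_erase _ _ (Finset.mem_univ k),
          ← Finset.mul_prod_erase _ (fun k : Fin (R + 1) => if k.val < n then c k else 1)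
            (Finset.mem_univ k)]
        simp only [k, lt_irrefl, if_false, one_mul, Nat.lt_succ_self, if_true]
        congr 1
        refine Finset.prod_congr rfl fun k' hk' => ?_
        have : k'.val ≠ n := fun h => (Finset.mem_erase.1 hk').1 (Fin.ext h)
        have : k'.val < n + 1 ↔ k'.val < n := by omega
        simp only [this]
      rw [hprod]
      refine (mul_le_mul_of_nonneg_left (ih (by omega)) (hc k)).trans ?_
      exact mul_uniformProb_le_of_resample {e | N.tail e = P.node k} fun K hK =>
        P.le_uniformProb_forall_cutIndep (k := k) hK (h' k)
  have hfinal := stage (R + 1) le_rfl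
  have hall : (∏ k : Fin (R + 1), if k.val < R + 1 then c k else 1) = ∏ k, c k :=
    Finset.prod_congr rfl fun k _ => if_pos k.2
  rw [hall] at hfinal
  have hle : (1 - stepFailure F w) ^ N.sinks.card *
      ∏ k : Fin R, (1 - P.excess k.castSucc * stepFailure F w) ≤ ∏ k, c k := by
    rw [Finset.prod_mul_distrib, Finset.prod_pow_eq_pow_sum, Fin.prod_univ_castSucc
      (fun k => 1 - P.excess k * stepFailure F w), excess_last, zero_mul, sub_zero, mul_one]
    refine mul_le_mul_of_nonneg_right ?_ (Finset.prod_nonneg fun k _ => sub_nonneg.2 (h k))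
    -- An inequality for the sum of the $n_k$ is enough, because $0\le 1-a\le 1$.
    exact pow_le_pow_of_le_one (one_sub_stepFailure_nonneg w) (one_sub_stepFailure_le_one w)
      P.sum_card_lastM_le
  rw [failureProb_eq, bound]
  refine sub_le_sub_left (hle.trans (hfinal.trans (uniformProb_mono fun K hK t ht => ?_))) _
  exact P.not_rank_lt_of_cutIndep ht (hK t ht)

end Stages

end ChosenPaths

end Network

namespace Network

/-! ### Sharpness: unions of plait networks -/

section PlaitUnion

variable {w l R : ℕ} [NeZero l]

/-- The index of the node from which the channels of the block `b` start. -/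
def plaitTail (R l : ℕ) [NeZero l] : Fin R ⊕ Fin l → Fin (R + 1) :=
  Sum.elim Fin.castSucc fun j => if j = 0 then Fin.last R else 0

theorem plaitUnion_tail (e : (Fin R ⊕ Fin l) × Fin w) :
    (plaitUnion w l R).tail e = Sum.inl (plaitTail R l e.1) := by
  rcases e with ⟨k | j, i⟩ <;> rfl

theorem mem_plaitUnion_sinks {t : Fin (R + 1) ⊕ Fin l} :
    t ∈ (plaitUnion w l R).sinks ↔ ∃ j, t = Sum.inr j := by
  simp [plaitUnion, eq_comm]

theorem card_plaitUnion_sinks : (plaitUnion w l R).sinks.card = l := by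
  simp [plaitUnion]

theorem lt_of_transGen_plaitUnion {x y : Fin (R + 1) ⊕ Fin l}
    (h : Relation.TransGen (plaitUnion w l R).Adj x y) :
    Sum.elim (fun k => k.val) (fun _ => R + 1) x < Sum.elim (fun k => k.val) (fun _ => R + 1) y := by
  have step : ∀ x y, (plaitUnion w l R).Adj x y →
      Sum.elim (fun k => k.val) (fun _ => R + 1) x <
        Sum.elim (fun k => k.val) (fun _ => R + 1) y := by
    rintro _ _ ⟨⟨k | j, i⟩, rfl, rfl⟩
    · simp [plaitUnion]
    · exact (plaitTail R l (Sum.inr j)).isLt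
  induction h with
  | single h => exact step _ _ h
  | tail _ h ih => exact ih.trans (step _ _ h)

theorem lt_of_transGen_plaitUnion_inl {k k' : Fin (R + 1)}
    (h : Relation.TransGen (plaitUnion w l R).Adj (Sum.inl k) (Sum.inl k')) : k < k' :=
  lt_of_transGen_plaitUnion h

theorem transGen_plaitUnion (hw : 0 < w) {k k' : Fin (R + 1)} (h : k < k') :
    Relation.TransGen (plaitUnion w l R).Adj (Sum.inl k) (Sum.inl k') := by
  induction k' using Fin.induction with
  | zero => exact absurd h (Fin.not_lt_zero k)
  | succ k' ih =>
    have hadj : (plaitUnion w l R).Adj (Sum.inl k'.castSucc) (Sum.inl k'.succ) :=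
      ⟨(Sum.inl k', ⟨0, hw⟩), rfl, rfl⟩
    rcases (Fin.le_castSucc_iff.2 h).eq_or_lt with rfl | h'
    · exact .single hadj
    · exact (ih h').tail hadj

/-! ### Existence of admissible paths -/

section Existence

/-- The channel with index `j` that starts from the node with index `k` of the long plait network. -/
def plaitChannel (w l R : ℕ) [NeZero l] (j : Fin w) (k : Fin (R + 1)) :
    (Fin R ⊕ Fin l) × Fin w :=
  (if h : k.val < R then Sum.inl ⟨k, h⟩ else Sum.inr 0, j)

theorem plaitUnion_tail_plaitChannel (j : Fin w) (k : Fin (R + 1)) :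
    (plaitUnion w l R).tail (plaitChannel w l R j k) = Sum.inl k := by
  rw [plaitUnion_tail, plaitChannel]
  split_ifs with h
  · rfl
  · simp only [plaitTail, Sum.elim_inr, if_true, Sum.inl.injEq]
    exact Fin.ext (by simp; omega)

/-- The paths of a union of plait networks to the sink `t`. -/
def plaitPath (w l R : ℕ) [NeZero l] (t : Fin (R + 1) ⊕ Fin l) (j : Fin w) :
    List ((Fin R ⊕ Fin l) × Fin w) :=
  Sum.elim (fun _ => []) (fun s => if s = 0 then List.ofFn (plaitChannel w l R j)
    else [(Sum.inr s, j)]) t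

theorem snd_of_mem_plaitPath {t : Fin (R + 1) ⊕ Fin l} {j : Fin w}
    {e : (Fin R ⊕ Fin l) × Fin w} (he : e ∈ plaitPath w l R t j) : e.2 = j := by
  rcases t with k | s
  · simp [plaitPath] at he
  · rw [plaitPath, Sum.elim_inr] at he
    split_ifs at he
    · obtain ⟨k, rfl⟩ := List.mem_ofFn.1 he
      rfl
    · rw [List.mem_singleton.1 he]

theorem isPath_plaitPath (s : Fin l) (j : Fin w) :
    (plaitUnion w l R).IsPath (Sum.inl 0) (Sum.inr s) (plaitPath w l R (Sum.inr s) j) := by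
  rw [plaitPath, Sum.elim_inr]
  split_ifs with hs
  · subst hs
    refine ⟨?_, ?_, ?_⟩
    · rw [List.isChain_iff_getElem]
      intro i hi
      rw [List.length_ofFn] at hi
      rw [List.getElem_ofFn, List.getElem_ofFn, plaitUnion_tail_plaitChannel, plaitChannel,
        dif_pos (show i < R by omega)]
      rfl
    · rw [List.ofFn_succ, List.head?_cons, Option.map_some, plaitUnion_tail_plaitChannel]
    · rw [List.ofFn_succ', List.concat_eq_append, List.getLast?_append]
      simp [plaitChannel, plaitUnion]
  · refine ⟨by simp, ?_, rfl⟩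
    simp [plaitUnion, hs]

/-- The standard choice of paths in a union of plait networks. -/
def plaitChosenPaths (l R : ℕ) [NeZero l] (hw : 0 < w) : (plaitUnion w l R).ChosenPaths w R where
  path := plaitPath w l R
  isPath t ht j := by
    obtain ⟨s, rfl⟩ := mem_plaitUnion_sinks.1 ht
    exact isPath_plaitPath s j
  disjoint t _ j j' hj e he he' :=
    hj ((snd_of_mem_plaitPath he).symm.trans (snd_of_mem_plaitPath he'))
  tail_notMem_sinks t _ j e _ := by
    rw [plaitUnion_tail, mem_plaitUnion_sinks]
    rintro ⟨s, hs⟩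
    cases hs
  node := Sum.inl
  node_injective := Sum.inl_injective
  node_zero := rfl
  range_node := by
    ext v
    constructor
    · rintro ⟨k, rfl⟩
      refine ⟨fun h => Fin.succ_ne_zero k (Sum.inl_injective h), Sum.inr 0,
        mem_plaitUnion_sinks.2 ⟨0, rfl⟩, ⟨0, hw⟩, plaitChannel w l R ⟨0, hw⟩ k.succ, ?_,
        plaitUnion_tail_plaitChannel _ _⟩
      rw [plaitPath, Sum.elim_inr, if_pos rfl]
      exact List.mem_ofFn.2 ⟨_, rfl⟩
    · rintro ⟨hv, t, -, j, e, -, rfl⟩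
      rw [plaitUnion_tail] at hv ⊢
      obtain ⟨k, hk⟩ := Fin.exists_succ_eq.2 fun h => hv (congrArg Sum.inl h)
      exact ⟨k, congrArg Sum.inl hk⟩
  topological _ _ := lt_of_transGen_plaitUnion_inl

end Existence

/-! ### Every admissible choice gives the same bound -/

section Choices

variable (P : (plaitUnion w l R).ChosenPaths w R)

/-- The nodes `inl k` are totally ordered by reachability. A topological enumeration is thus a
strictly monotone self-bijection of `Fin (R + 1)`, which must be the identity. -/
theorem plaitUnion_node_eq (hw : 0 < w) (k : Fin (R + 1)) : P.node k = Sum.inl k := by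
  have (k : Fin (R + 1)) : ∃ k', P.node k = Sum.inl k' := by
    induction k using Fin.cases with
    | zero => exact ⟨0, P.node_zero⟩
    | succ k =>
      obtain ⟨-, t, -, j, e, -, he⟩ := P.range_node.subset ⟨k, rfl⟩
      exact ⟨_, he.symm.trans (plaitUnion_tail e)⟩
  choose f hf using this
  have hinj : Function.Injective f := fun k k' h =>
    P.node_injective (by rw [hf, hf, h])
  have hmono : StrictMono f := by
    intro k k' h
    by_contra hlt
    have : f k' < f k := lt_of_le_of_ne (not_lt.1 hlt) fun h' => h.ne' (hinj h')
    refine lt_asymm h (P.topological _ _ ?_)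
    rw [hf, hf]
    exact transGen_plaitUnion hw this
  have hid : f = id := by
    refine (StrictMono.range_inj hmono strictMono_id).1 ?_
    rw [(Finite.surjective_of_injective hinj).range_eq, Set.range_id]
  rw [hf, hid, id]

theorem inr_zero_mem_plaitUnion_M (hw : 0 < w) (k : Fin (R + 1)) : Sum.inr 0 ∈ P.M k := by
  have hs : (Sum.inr 0 : Fin (R + 1) ⊕ Fin l) ∈ (plaitUnion w l R).sinks :=
    mem_plaitUnion_sinks.2 ⟨0, rfl⟩
  refine P.mem_M.2 ⟨hs, ⟨0, hw⟩, ?_⟩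
  have hp := P.isPath _ hs ⟨0, hw⟩
  rw [plaitUnion_node_eq P hw]
  induction k using Fin.induction with
  | zero => exact hp.exists_tail_eq
  | succ k ih =>
    obtain ⟨⟨b, i⟩, he, hk⟩ := ih
    rw [plaitUnion_tail] at hk
    rcases b with k' | s
    · obtain rfl : k' = k := Fin.castSucc_injective _ (Sum.inl_injective hk)
      rcases hp.head_eq_or he with h | ⟨d, hd, h, -⟩
      · cases h
      · exact ⟨d, hd, h.symm⟩
    · rcases hp.head_eq_or he with h | ⟨d, hd, h, -⟩
      · obtain rfl : s = 0 := Sum.inr_injective h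
        have : Fin.last R = k.castSucc := by simpa [plaitTail] using hk
        exact absurd this (Fin.castSucc_lt_last k).ne'
      · rw [plaitUnion_tail] at h
        cases h

/-- The last channel of a path to `inr s` leaves the source, and acyclicity leaves no room for a
channel before it. -/
theorem eq_zero_of_inr_mem_plaitUnion_M (hw : 0 < w) {k : Fin (R + 1)} {s : Fin l} (hs : s ≠ 0)
    (h : Sum.inr s ∈ P.M k) : k = 0 := by
  obtain ⟨ht, j, e, he, hk⟩ := P.mem_M.1 h
  have hp := P.isPath _ ht j
  generalize P.path (Sum.inr s) j = p at he hp
  rcases p.eq_nil_or_concat with rfl | ⟨q, d, rfl⟩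
  · exact absurd rfl hp.ne_nil
  rw [List.concat_eq_append] at he hp
  have hd : (plaitUnion w l R).tail d = Sum.inl 0 := by
    have := hp.2.2
    simp only [List.getLast?_append, List.getLast?_singleton, Option.some_or, Option.map_some,
      Option.some.injEq] at this
    rcases d with ⟨k' | s', i⟩
    · cases this
    · obtain rfl : s' = s := Sum.inr_injective this
      simp [plaitUnion, hs]
  rw [plaitUnion_node_eq P hw] at hk
  rcases List.mem_append.1 he with he | he
  · have := (List.pairwise_append.1 hp.pairwise).2.2 e he d (by simp)
    rw [hk, hd] at this
    exact absurd (lt_of_transGen_plaitUnion_inl this) (Fin.not_lt_zero k)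
  · rw [List.mem_singleton.1 he, hd] at hk
    exact (Sum.inl_injective hk).symm

/-- The long plait's sink passes through every node and so is not finished before `i_R`; every other
sink that meets a node is finished there. -/
theorem plaitUnion_excess (hw : 0 < w) (k : Fin R) : P.excess k.castSucc = 1 := by
  rw [P.excess_eq]
  refine Nat.cast_eq_one.2 (Finset.card_eq_one.2 ⟨Sum.inr 0, ?_⟩)
  ext t
  rw [Finset.mem_sdiff, Finset.mem_singleton, P.mem_lastM]
  constructor
  · rintro ⟨ht, hlast⟩
    obtain ⟨s, rfl⟩ := mem_plaitUnion_sinks.1 (P.mem_M.1 ht).1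
    by_contra hs
    have hs' : s ≠ 0 := fun h => hs (congrArg Sum.inr h)
    refine hlast ⟨ht, fun k' hk' hM => ?_⟩
    rw [eq_zero_of_inr_mem_plaitUnion_M P hw hs' hM] at hk'
    exact Fin.not_lt_zero _ hk'
  · rintro rfl
    exact ⟨inr_zero_mem_plaitUnion_M P hw _, fun h =>
      h.2 k.succ Fin.castSucc_lt_succ (inr_zero_mem_plaitUnion_M P hw _)⟩

theorem plaitUnion_bound (hw : 0 < w) (F : Type*) [Fintype F] :
    P.bound F = 1 - (1 - stepFailure F w) ^ (R + l) := by
  simp only [ChosenPaths.bound, plaitUnion_excess P hw, card_plaitUnion_sinks, one_mul,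
    Finset.prod_const, Finset.card_univ, Fintype.card_fin]
  rw [← pow_add, add_comm]

end Choices

/-! ### Exact failure probability -/

section Probability

theorem _root_.Matrix.not_rank_lt_iff_det_ne_zero {F : Type*} [Field F]
    (A : Matrix (Fin w) (Fin w) F) : ¬ A.rank < w ↔ A.det ≠ 0 := by
  rw [← isUnit_iff_ne_zero, ← Matrix.isUnit_iff_isUnit_det,
    ← Matrix.linearIndependent_rows_iff_isUnit, linearIndependent_iff_card_le_finrank_span,
    Fintype.card_fin, not_lt, Matrix.rank_eq_finrank_span_row]
  rfl

/-- The channels entering the node with index `k` of the long plait network. -/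
def plaitIncoming (l : ℕ) (k : Fin (R + 1)) (i : Fin w) : Fin w ⊕ (Fin R ⊕ Fin l) × Fin w :=
  Fin.cases (Sum.inl i) (fun k' => Sum.inr (Sum.inl k', i)) k

theorem headExt_plaitIncoming (k : Fin (R + 1)) (i : Fin w) :
    (plaitUnion w l R).headExt (plaitIncoming l k i) = Sum.inl k := by
  induction k using Fin.cases <;> rfl

theorem plaitIncoming_bijective (k : Fin (R + 1)) :
    Function.Bijective fun i : Fin w => (⟨plaitIncoming l k i, headExt_plaitIncoming k i⟩ :
      {d // (plaitUnion w l R).headExt d = Sum.inl k}) := by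
  constructor
  · intro i i' h
    have h' := congrArg Subtype.val h
    induction k using Fin.cases with
    | zero => exact Sum.inl_injective h'
    | succ k => exact congrArg Prod.snd (Sum.inr_injective h')
  · rintro ⟨d, hd⟩
    rcases d with i | ⟨k' | s, i⟩
    · obtain rfl : 0 = k := Sum.inl_injective hd
      exact ⟨i, rfl⟩
    · obtain rfl : k'.succ = k := Sum.inl_injective hd
      exact ⟨i, rfl⟩
    · cases hd

/-- Enumeration of the channels entering the node with index `k` of the long plait network. -/
noncomputable def plaitIncomingEquiv (w l : ℕ) [NeZero l] (k : Fin (R + 1)) :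
    Fin w ≃ {d : Fin w ⊕ (Fin R ⊕ Fin l) × Fin w //
      (plaitUnion w l R).headExt d = Sum.inl k} :=
  Equiv.ofBijective _ (plaitIncoming_bijective k)

variable {F : Type*} [Field F]

/-- The matrix of the local encoding coefficients of the channels of the block `b`. -/
def plaitCoeff (K : (plaitUnion w l R).Coeff F w) (b : Fin R ⊕ Fin l) :
    Matrix (Fin w) (Fin w) F :=
  Matrix.of fun i i' => K (b, i) ⟨plaitIncoming l (plaitTail R l b) i',
    (headExt_plaitIncoming _ i').trans (plaitUnion_tail (b, i)).symm⟩

/-- The matrix whose rows are the kernels of the channels entering the node with index `k`. -/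
noncomputable def plaitIncomingKernels (K : (plaitUnion w l R).Coeff F w) (k : Fin (R + 1)) :
    Matrix (Fin w) (Fin w) F :=
  Matrix.of fun i => kernelExt K (plaitIncoming l k i)

/-- The matrix whose rows are the kernels of the channels of the block `b`. -/
noncomputable def plaitKernels (K : (plaitUnion w l R).Coeff F w) (b : Fin R ⊕ Fin l) :
    Matrix (Fin w) (Fin w) F :=
  Matrix.of fun i => (plaitUnion w l R).kernel K (b, i)

theorem plaitKernels_eq (K : (plaitUnion w l R).Coeff F w) (b : Fin R ⊕ Fin l) :
    plaitKernels K b = plaitCoeff K b * plaitIncomingKernels K (plaitTail R l b) := by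
  classical
  ext i c
  rw [plaitKernels, Matrix.of_apply, kernel_eq_sum, Finset.sum_apply, Matrix.mul_apply]
  refine (Fintype.sum_equiv ((plaitIncomingEquiv w l (plaitTail R l b)).trans
    (Equiv.subtypeEquivRight fun d => by rw [plaitUnion_tail])) _ _ fun i' => ?_).symm
  rfl

theorem plaitIncomingKernels_zero (K : (plaitUnion w l R).Coeff F w) :
    plaitIncomingKernels K 0 = 1 := by
  ext i c
  change (Pi.single i 1 : Fin w → F) c = _
  rw [Pi.single_apply, Matrix.one_apply]
  simp only [eq_comm]

theorem forall_det_plaitKernels_ne_zero_iff (K : (plaitUnion w l R).Coeff F w) :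
    (∀ s, (plaitKernels K (Sum.inr s)).det ≠ 0) ↔ ∀ b, (plaitCoeff K b).det ≠ 0 := by
  have hdet (b) : (plaitKernels K b).det ≠ 0 ↔ (plaitCoeff K b).det ≠ 0 ∧
      (plaitIncomingKernels K (plaitTail R l b)).det ≠ 0 := by
    rw [plaitKernels_eq, Matrix.det_mul, mul_ne_zero_iff]
  constructor
  · intro h
    have hin : ∀ k, (plaitIncomingKernels K k).det ≠ 0 := by
      intro k
      -- Invertibility propagates upstream from sink `0`: if the kernels entering node `k + 1` form
      -- an invertible product, so does its right factor, the kernels entering node `k`.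
      induction k using Fin.reverseInduction with
      | last =>
        have := ((hdet _).1 (h 0)).2
        simpa [plaitTail] using this
      | cast k ih => exact ((hdet (Sum.inl k)).1 ih).2
    rintro (k | s)
    · exact ((hdet (Sum.inl k)).1 (hin k.succ)).1
    · exact ((hdet _).1 (h s)).1
  · intro h s
    have hin : ∀ k, (plaitIncomingKernels K k).det ≠ 0 := by
      intro k
      induction k using Fin.induction with
      | zero => rw [plaitIncomingKernels_zero, Matrix.det_one]; exact one_ne_zero
      | succ k ih => exact (hdet (Sum.inl k)).2 ⟨h _, ih⟩
    exact (hdet _).2 ⟨h _, hin _⟩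

theorem plaitUnion_rank_decodingMatrix (K : (plaitUnion w l R).Coeff F w) (s : Fin l)
    [Fintype {e // (plaitUnion w l R).head e = Sum.inr s}] :
    ((plaitUnion w l R).decodingMatrix K (Sum.inr s)).rank = (plaitKernels K (Sum.inr s)).rank := by
  have hbij : Function.Bijective fun i : Fin w => (⟨(Sum.inr s, i), rfl⟩ :
      {e // (plaitUnion w l R).head e = Sum.inr s}) := by
    constructor
    · intro i i' h
      exact congrArg (fun e => e.1.2) h
    · rintro ⟨⟨k | s', i⟩, he⟩
      · cases he
      · obtain rfl : s' = s := Sum.inr_injective he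
        exact ⟨i, rfl⟩
  rw [← Matrix.rank_submatrix _ (Equiv.refl _) (Equiv.ofBijective _ hbij), ← Matrix.rank_transpose]
  rfl

theorem dependsOnlyOn_det_plaitCoeff_ne_zero (b : Fin R ⊕ Fin l) :
    DependsOnlyOn {e | e.1 = b} fun K : (plaitUnion w l R).Coeff F w =>
      (plaitCoeff K b).det ≠ 0 := by
  intro K K' h
  have : plaitCoeff K b = plaitCoeff K' b := by
    ext i i'
    exact congrFun (h (b, i) rfl) _
  simp only [this]

variable [Fintype F]

theorem uniformProb_det_plaitCoeff_ne_zero (b : Fin R ⊕ Fin l) :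
    uniformProb (fun K : (plaitUnion w l R).Coeff F w => (plaitCoeff K b).det ≠ 0) =
      1 - stepFailure F w := by
  let φ : (plaitUnion w l R).Coeff F w →+ (Fin w → Fin w → F) :=
    { toFun := fun K => plaitCoeff K b
      map_zero' := rfl
      map_add' := fun _ _ => rfl }
  have hφ : Function.Surjective φ := by
    intro y
    -- A prescribed matrix fills the coefficients of block `b`; all other blocks are set to zero.
    refine ⟨fun e d => if e.1 = b then y e.2 ((plaitIncomingEquiv w l (plaitTail R l e.1)).symm
      ⟨d.1, d.2.trans (plaitUnion_tail e)⟩) else 0, ?_⟩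
    ext i i'
    refine (if_pos rfl).trans (congrArg (y i) ?_)
    exact (plaitIncomingEquiv w l (plaitTail R l b)).symm_apply_apply i'
  have h := uniformProb_linearIndependent (F := F) (ι := Fin w) (Q := Fin w → F) (by simp)
  rw [Fintype.card_fin] at h
  rw [← h, ← uniformProb_comp_of_surjective φ hφ]
  refine uniformProb_congr fun K => ?_
  rw [← isUnit_iff_ne_zero, ← Matrix.isUnit_iff_isUnit_det,
    ← Matrix.linearIndependent_rows_iff_isUnit]
  rfl

theorem uniformProb_forall_det_plaitCoeff_ne_zero :
    uniformProb (fun K : (plaitUnion w l R).Coeff F w => ∀ b, (plaitCoeff K b).det ≠ 0) =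
      (1 - stepFailure F w) ^ (R + l) := by
  have hindep := uniformProb_forall_and_of_dependsOnlyOn Prod.fst Finset.univ
    (q := fun _ => True)
    (fun b _ => dependsOnlyOn_det_plaitCoeff_ne_zero (w := w) (l := l) (R := R) (F := F) b)
    (fun _ _ _ => Iff.rfl)
  rw [uniformProb_of_forall fun _ => trivial, mul_one,
    Finset.prod_congr rfl fun b _ => uniformProb_det_plaitCoeff_ne_zero b, Finset.prod_const,
    Finset.card_univ, Fintype.card_sum, Fintype.card_fin, Fintype.card_fin] at hindep
  rw [← hindep]
  exact uniformProb_congr fun K => ⟨fun h => ⟨fun b _ => h b, trivial⟩,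
    fun h b => h.1 b (Finset.mem_univ b)⟩

theorem plaitUnion_failureProb :
    (plaitUnion w l R).failureProb F w = 1 - (1 - stepFailure F w) ^ (R + l) := by
  rw [failureProb_eq, ← uniformProb_forall_det_plaitCoeff_ne_zero]
  refine congrArg (1 - ·) (uniformProb_congr fun K => ?_)
  rw [← forall_det_plaitKernels_ne_zero_iff]
  constructor
  · intro h s
    have hs := h (Sum.inr s) (mem_plaitUnion_sinks.2 ⟨s, rfl⟩)
    rwa [plaitUnion_rank_decodingMatrix, Matrix.not_rank_lt_iff_det_ne_zero] at hs
  · intro h t ht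
    obtain ⟨s, rfl⟩ := mem_plaitUnion_sinks.1 ht
    rw [plaitUnion_rank_decodingMatrix, Matrix.not_rank_lt_iff_det_ne_zero]
    exact h s

end Probability

end PlaitUnion

end Network

theorem theorem1 (F : Type*) [Field F] [Fintype F] (w : ℕ) :
    (∀ (V : Type*) (E : Type*) [Finite V] [Fintype E] (N : Network V E) (R : ℕ)
      (P : N.ChosenPaths w R),
      (∀ k : Fin R, P.excess k.castSucc * stepFailure F w ≤ 1) →
        N.failureProb F w ≤ P.bound F) ∧
    (0 < w → ∀ (l R : ℕ) [NeZero l],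
      (Network.plaitUnion w l R).sinks.card = l ∧
      Nonempty ((Network.plaitUnion w l R).ChosenPaths w R) ∧
      (∀ P : (Network.plaitUnion w l R).ChosenPaths w R,
        (∀ k : Fin R, P.excess k.castSucc * stepFailure F w ≤ 1) ∧
        (Network.plaitUnion w l R).failureProb F w = P.bound F) ∧
      (Network.plaitUnion w l R).failureProb F w = 1 - (1 - stepFailure F w) ^ (R + l)) := by
  refine ⟨fun V E _ _ N R P h => P.failureProb_le_bound h, fun hw l R _ =>
    ⟨Network.card_plaitUnion_sinks, ⟨Network.plaitChosenPaths l R hw⟩, fun P => ⟨fun k => ?_, ?_⟩,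
      Network.plaitUnion_failureProb⟩⟩
  · rw [Network.plaitUnion_excess P hw, one_mul]
    exact sub_nonneg.1 (one_sub_stepFailure_nonneg w)
  · rw [Network.plaitUnion_bound P hw, Network.plaitUnion_failureProb]
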